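/- All rings are associative with unity, not necessarily commutative. Let $R$ be a subring of a ring $A$ and let $x_1,\dots,x_n\in A$ be such that $A=\sigma(R)\langle x_1,\dots,x_n\rangle$ is a skew PBW extension of $R$, that is: (a) $A$ is a free left $R$-module with basis the monomials $x^\alpha=x_1^{\alpha_1}\cdots x_n^{\alpha_n}$, $\alpha\in\mathbb{N}^n$ (with $x^0=1$); (b) for every $1\le i\le n$ and every $r\in R\setminus\{0\}$ there is $c_{i,r}\in R\setminus\{0\}$ with $x_ir-c_{i,r}x_i\in R$; (c) for all $1\le i,j\le n$ there is $c_{i,j}\in R\setminus\{0\}$ with $x_jx_i-c_{i,j}x_ix_j\in R+Rx_1+\cdots+Rx_n$. For each $i$ let $\sigma_i:R\to R$ be the (unique, injective) ring endomorphism and $\delta_i:R\to R$ the (unique) $\sigma_i$-derivation such that $x_ir=\sigma_i(r)x_i+\delta_i(r)$ for all $r\in R$. Assume that the extension is bijective, i.e. that every $\sigma_i$ is bijective and $c_{i,j}$ is invertible in $R$ for all $1\le i<j\le n$. Assume also that $R$ is skew-Armendariz with respect to this extension, i.e. that whenever $f=\sum_\alpha a_\alpha x^\alpha$ and $g=\sum_\beta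 b_\beta x^\beta$ in $A$ (finite sums, $a_\alpha,b_\beta\in R$) satisfy $fg=0$, one has $a_0b_\beta=0$ for every $\beta\in\mathbb{N}^n$, where $a_0$ is the coefficient of $x^0=1$ in $f$. Call a ring $B$ a right (resp. left) p.p.-ring if for every $a\in B$ the right annihilator $\{b\in B: ab=0\}$ equals $eB$ (resp. the left annihilator $\{b\in B: ba=0\}$ equals $Be$) for some idempotent $e\in B$. Then $R$ is a right p.p.-ring if and only if $A$ is a right p.p.-ring, and $R$ is a left p.p.-ring if and only if $A$ is a left p.p.-ring. -/

import Mathlib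

namespace SkewPBW

noncomputable section

/-- The standard monomial `x_1 ^ α_1 * ⋯ * x_n ^ α_n`, the factors being multiplied in this order. -/
def stdMonomial {A : Type*} [Ring A] {n : ℕ} (x : Fin n → A) (α : Fin n → ℕ) : A :=
  (List.ofFn fun i => x i ^ α i).prod

/-- `A` is a skew PBW extension of its subring `R` in the elements `x_1, …, x_n` of `A`,
written `A = σ(R)⟨x_1, …, x_n⟩`. The scalar action of `R` on `A` is left multiplication. -/
structure IsSkewPBWExtension {A : Type*} [Ring A] (R : Subring A) {n : ℕ} (x : Fin n → A) :
    Prop where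
  /-- The standard monomials are left linearly independent over `R`. -/
  linearIndependent : LinearIndependent R (stdMonomial x)
  /-- The standard monomials span `A` as a left `R`-module. -/
  span_eq_top : ⊤ ≤ Submodule.span R (Set.range (stdMonomial x))
  /-- For every `i` and `r ≠ 0` there is `c ≠ 0` with `x_i r - c x_i ∈ R`. -/
  exists_coeff : ∀ (i : Fin n) (r : R), r ≠ 0 →
    ∃ c : R, c ≠ 0 ∧ x i * (r : A) - (c : A) * x i ∈ R
  /-- For all `i, j` there is `c ≠ 0` with `x_j x_i - c x_i x_j ∈ R + R x_1 + ⋯ + R x_n`. -/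
  exists_swap : ∀ i j : Fin n, ∃ c : R, c ≠ 0 ∧
    ∃ (r₀ : R) (r : Fin n → R),
      x j * x i - (c : A) * (x i * x j) = (r₀ : A) + ∑ k, (r k : A) * x k

section basic

variable {A : Type*} [Ring A] {n : ℕ}

theorem stdMonomial_zero (x : Fin n → A) : stdMonomial x 0 = 1 := by
  simp [stdMonomial]

theorem stdMonomial_succ (x : Fin (n + 1) → A) (α : Fin (n + 1) → ℕ) :
    stdMonomial x α = x 0 ^ α 0 * stdMonomial (fun i => x i.succ) (fun i => α i.succ) := by
  simp [stdMonomial, List.ofFn_succ]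

theorem stdMonomial_single (x : Fin n → A) (i : Fin n) :
    stdMonomial x (Pi.single i 1) = x i := by
  induction n with
  | zero => exact i.elim0
  | succ n ih =>
    rw [stdMonomial_succ]
    refine Fin.cases ?_ (fun i => ?_) i
    · have : (fun k : Fin n => (Pi.single 0 1 : Fin (n + 1) → ℕ) k.succ) = 0 := by
        ext k; simp
      rw [this, stdMonomial_zero]; simp
    · have : (fun k : Fin n => (Pi.single i.succ 1 : Fin (n + 1) → ℕ) k.succ)
          = Pi.single i 1 := by
        ext k; simp [Pi.single_apply]
      rw [this, ih]; simp [(Fin.succ_ne_zero i).symm]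

theorem stdMonomial_single_add_single (x : Fin n → A) {i j : Fin n} (hij : i < j) :
    stdMonomial x (Pi.single i 1 + Pi.single j 1) = x i * x j := by
  induction n with
  | zero => exact i.elim0
  | succ n ih =>
    rw [stdMonomial_succ]
    obtain ⟨j, rfl⟩ := Fin.exists_succ_eq.2 (Fin.ne_zero_of_lt hij)
    revert hij
    refine Fin.cases (fun _ => ?_) (fun i hij => ?_) i
    · have : (fun k : Fin n => (Pi.single 0 1 + Pi.single j.succ 1 : Fin (n + 1) → ℕ) k.succ)
          = Pi.single j 1 := by
        ext k; simp [Pi.single_apply]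
      rw [this, stdMonomial_single]; simp [(Fin.succ_ne_zero j).symm]
    · have : (fun k : Fin n => (Pi.single i.succ 1 + Pi.single j.succ 1 : Fin (n + 1) → ℕ) k.succ)
          = Pi.single i 1 + Pi.single j 1 := by
        ext k; simp [Pi.single_apply]
      rw [this, ih _ (Fin.succ_lt_succ_iff.1 hij)]
      simp [(Fin.succ_ne_zero i).symm, (Fin.succ_ne_zero j).symm]

end basic

namespace IsSkewPBWExtension

variable {A : Type*} [Ring A] {R : Subring A} {n : ℕ} {x : Fin n → A}

/-- The left `R`-basis of `A` formed by the standard monomials. -/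
def basis (h : IsSkewPBWExtension R x) : Module.Basis (Fin n → ℕ) R A :=
  Module.Basis.mk h.linearIndependent h.span_eq_top

/-- The coefficient in `R` of the standard monomial with exponent `α` in `f`. -/
def coeff (h : IsSkewPBWExtension R x) (f : A) (α : Fin n → ℕ) : R :=
  h.basis.repr f α

theorem basis_apply (h : IsSkewPBWExtension R x) (α : Fin n → ℕ) :
    h.basis α = stdMonomial x α := by
  simp [basis]

theorem coeff_add (h : IsSkewPBWExtension R x) (f g : A) (α : Fin n → ℕ) :
    h.coeff (f + g) α = h.coeff f α + h.coeff g α := by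
  simp [coeff]

theorem coeff_mul_left (h : IsSkewPBWExtension R x) (r : R) (f : A) (α : Fin n → ℕ) :
    h.coeff ((r : A) * f) α = r * h.coeff f α := by
  have : (r : A) * f = r • f := rfl
  rw [this]; simp [coeff]

theorem coeff_stdMonomial (h : IsSkewPBWExtension R x) (α β : Fin n → ℕ) :
    h.coeff (stdMonomial x α) β = if α = β then 1 else 0 := by
  rw [← h.basis_apply, coeff, Module.Basis.repr_self, Finsupp.single_apply]

theorem coeff_coe (h : IsSkewPBWExtension R x) (r : R) (α : Fin n → ℕ) :
    h.coeff (r : A) α = if 0 = α then r else 0 := by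
  have := h.coeff_mul_left r (stdMonomial x 0) α
  rw [coeff_stdMonomial, stdMonomial_zero, mul_one] at this
  rw [this]; split_ifs <;> simp

theorem coeff_var (h : IsSkewPBWExtension R x) (i : Fin n) (α : Fin n → ℕ) :
    h.coeff (x i) α = if Pi.single i 1 = α then 1 else 0 := by
  conv_lhs => rw [← stdMonomial_single x i]
  exact h.coeff_stdMonomial _ _

theorem coeff_linear (h : IsSkewPBWExtension R x) (i : Fin n) (c d : R) :
    h.coeff ((c : A) * x i + (d : A)) (Pi.single i 1) = c ∧
      h.coeff ((c : A) * x i + (d : A)) 0 = d := by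
  have h1 : (Pi.single i 1 : Fin n → ℕ) ≠ 0 := by simp
  constructor
  · rw [coeff_add, coeff_mul_left, coeff_var, coeff_coe]; simp [h1.symm]
  · rw [coeff_add, coeff_mul_left, coeff_var, coeff_coe]; simp

/-- The map `σ_i`, as a function: `σ_i(r)` is the coefficient of `x_i` in `x_i r`. -/
def sigmaFun (h : IsSkewPBWExtension R x) (i : Fin n) (r : R) : R :=
  h.coeff (x i * (r : A)) (Pi.single i 1)

/-- The `σ_i`-derivation `δ_i`: `δ_i(r)` is the constant coefficient of `x_i r`. -/
def delta (h : IsSkewPBWExtension R x) (i : Fin n) (r : R) : R :=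
  h.coeff (x i * (r : A)) 0

theorem var_mul_coe_aux (h : IsSkewPBWExtension R x) (i : Fin n) (r : R) :
    x i * (r : A) = (h.sigmaFun i r : A) * x i + (h.delta i r : A) := by
  obtain ⟨c, d, hcd⟩ : ∃ c d : R, x i * (r : A) = (c : A) * x i + (d : A) := by
    by_cases hr : r = 0
    · exact ⟨0, 0, by simp [hr]⟩
    · obtain ⟨c, -, hc⟩ := h.exists_coeff i r hr
      exact ⟨c, ⟨_, hc⟩, by simp⟩
  have := h.coeff_linear i c d
  rw [sigmaFun, delta, hcd, this.1, this.2]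

theorem sigmaFun_eq (h : IsSkewPBWExtension R x) (i : Fin n) {r c d : R}
    (hcd : x i * (r : A) = (c : A) * x i + (d : A)) : h.sigmaFun i r = c := by
  rw [sigmaFun, hcd, (h.coeff_linear i c d).1]

/-- The endomorphism `σ_i` of `R`, determined by `x_i r = σ_i(r) x_i + δ_i(r)`. -/
def sigma (h : IsSkewPBWExtension R x) (i : Fin n) : R →+* R where
  toFun := h.sigmaFun i
  map_zero' := h.sigmaFun_eq i (d := 0) (by simp)
  map_one' := h.sigmaFun_eq i (d := 0) (by simp)
  map_add' r s := h.sigmaFun_eq i (d := h.delta i r + h.delta i s) (by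
    push_cast
    rw [mul_add, h.var_mul_coe_aux i r, h.var_mul_coe_aux i s, add_mul]
    abel)
  map_mul' r s := h.sigmaFun_eq i
    (d := h.sigmaFun i r * h.delta i s + h.delta i r * s) (by
    push_cast
    rw [← mul_assoc, h.var_mul_coe_aux i r, add_mul, mul_assoc _ (x i), h.var_mul_coe_aux i s,
      mul_add, mul_assoc]
    abel)

theorem var_mul_coe (h : IsSkewPBWExtension R x) (i : Fin n) (r : R) :
    x i * (r : A) = (h.sigma i r : A) * x i + (h.delta i r : A) :=
  h.var_mul_coe_aux i r

/-- The element `c_{i,j}` of `R`, for `i < j`: the coefficient of `x_i x_j` in `x_j x_i`. -/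
def swapCoeff (h : IsSkewPBWExtension R x) (i j : Fin n) : R :=
  h.coeff (x j * x i) (Pi.single i 1 + Pi.single j 1)

theorem swapCoeff_spec (h : IsSkewPBWExtension R x) {i j : Fin n} (hij : i < j) :
    ∃ (r₀ : R) (r : Fin n → R),
      x j * x i - (h.swapCoeff i j : A) * (x i * x j) = (r₀ : A) + ∑ k, (r k : A) * x k := by
  obtain ⟨c, -, r₀, r, hc⟩ := h.exists_swap i j
  suffices hs : h.swapCoeff i j = c from ⟨r₀, r, by rw [hs]; exact hc⟩
  have hdeg : ∀ α : Fin n → ℕ, ∑ k, α k < 2 → α ≠ Pi.single i 1 + Pi.single j 1 := by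
    rintro α hα rfl
    simp [Finset.sum_add_distrib] at hα
  have hsum : ∀ s : Finset (Fin n),
      h.coeff (∑ k ∈ s, (r k : A) * x k) (Pi.single i 1 + Pi.single j 1) = 0 := by
    intro s
    induction s using Finset.induction_on with
    | empty => simp [coeff]
    | insert k s hk ih =>
      rw [Finset.sum_insert hk, coeff_add, ih, coeff_mul_left, coeff_var,
        if_neg (hdeg _ (by simp))]
      simp
  rw [swapCoeff, sub_eq_iff_eq_add.1 hc, ← stdMonomial_single_add_single x hij, coeff_add,
    coeff_add, hsum, coeff_coe, if_neg (hdeg 0 (by simp)), coeff_mul_left, coeff_stdMonomial]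
  simp

/-- The extension is bijective: every `σ_i` is bijective and `c_{i,j}` is invertible in `R`
for all `i < j`. -/
def IsBijective (h : IsSkewPBWExtension R x) : Prop :=
  (∀ i, Function.Bijective (h.sigma i)) ∧ ∀ i j, i < j → IsUnit (h.swapCoeff i j)

/-- `R` is skew-Armendariz (with respect to the given extension): if `f g = 0` in `A`, then the
constant coefficient of `f` annihilates on the left every coefficient of `g`. -/
def IsSkewArmendariz (h : IsSkewPBWExtension R x) : Prop :=
  ∀ f g : A, f * g = 0 → ∀ β : Fin n → ℕ, h.coeff f 0 * h.coeff g β = 0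

end IsSkewPBWExtension

/-- Right p.p.-rings: the right annihilator of every element is `eB` for an idempotent `e`. -/
def IsRightPP (B : Type*) [Ring B] : Prop :=
  ∀ a : B, ∃ e : B, IsIdempotentElem e ∧ {b : B | a * b = 0} = {b : B | ∃ c, b = e * c}

/-- Left p.p.-rings: the left annihilator of every element is `Be` for an idempotent `e`. -/
def IsLeftPP (B : Type*) [Ring B] : Prop :=
  ∀ a : B, ∃ e : B, IsIdempotentElem e ∧ {b : B | b * a = 0} = {b : B | ∃ c, b = c * e}

end

end SkewPBW

/-!
The first point is that a skew-Armendariz extension in at least one variable has very few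
idempotents. Products of linear polynomials that vanish for a trivial reason show, for an idempotent
`e` of `R`, that `δ_i(e) = 0`, that `σ_i(e) = e` and that `e` commutes with every element of `R`
(`IsSkewArmendariz.delta_eq_zero`, `IsSkewArmendariz.sigma_eq_self`,
`IsSkewArmendariz.idempotent_comm`). Hence `e` is central in `A`. The condition applied to
`e (1 - e) = 0` and `(1 - e) e = 0` shows that every idempotent of `A` lies in `R`
(`IsSkewArmendariz.exists_coe_eq_of_idempotent`). In a ring with central idempotents the left and
the right p.p.-property are equivalent (`isRightPP_iff_isLeftPP`), so it suffices to treat the right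
one. It descends from `A` to `R` because the idempotents of `A` are those of `R`.

Conversely, let `R` be a right p.p.-ring. The right annihilator in `A` of `f = ∑ a_α x^α` is `eA`,
where the idempotent `e` generates the intersection of the right annihilators in `R` of the `a_α`,
as soon as `f g = 0` implies `a_α b_β = 0` for all `α` and `β`
(`IsSkewArmendariz.coeff_mul_coeff_eq_zero`). For leading coefficients with respect to the
degree-lexicographic order this follows from bijectivity, since the leading coefficient of a product
is obtained from those of the factors by applying the `σ_i` and multiplying by units, and
`a σ_i(r) = 0` implies `a r = 0` because the `σ_i` fix the idempotent generating the annihilator of `a`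
(`IsBijective.leadingCoeff_mul_eq_zero`). If `q` is the idempotent generating the right annihilator of
the leading coefficient of `f`, then `(q f) g = 0` and `f ((1 - q) g) = 0`, and in each of the two
products one factor has lost its leading term; so induction on the number of terms applies.

If there are no variables, then `A = R`.
-/

namespace SkewPBW

/-! ### Rings whose annihilators are generated by idempotents -/

section Ring

variable {B : Type*} [Ring B]

/-- If the idempotents are central, a right p.p.-ring is reduced, so that left and right
annihilators of an element agree. -/
theorem IsRightPP.isLeftPP (hB : IsRightPP B)
    (hc : ∀ e : B, IsIdempotentElem e → ∀ b, e * b = b * e) : IsLeftPP B := by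
  have hred : ∀ a : B, a * a = 0 → a = 0 := by
    intro a ha
    obtain ⟨e, he, hae⟩ := hB a
    obtain ⟨c, hac⟩ : ∃ c, a = e * c := (Set.ext_iff.1 hae a).1 ha
    have h0 : a * e = 0 := (Set.ext_iff.1 hae e).2 ⟨1, by simp⟩
    rw [← hc e he, hac, ← mul_assoc, he.eq] at h0
    rw [hac, h0]
  intro a
  obtain ⟨e, he, hae⟩ := hB a
  have h0 : a * e = 0 := (Set.ext_iff.1 hae e).2 ⟨1, by simp⟩
  refine ⟨e, he, Set.ext fun b => ⟨fun hb => ?_, ?_⟩⟩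
  · have hb : b * a = 0 := hb
    have hab : a * b = 0 := hred _ (by rw [mul_assoc, ← mul_assoc b, hb]; simp)
    obtain ⟨c, rfl⟩ := (Set.ext_iff.1 hae b).1 hab
    exact ⟨c, hc e he c⟩
  · rintro ⟨c, rfl⟩
    change c * e * a = 0
    rw [mul_assoc, hc e he, h0, mul_zero]

theorem isRightPP_mulOpposite : IsRightPP Bᵐᵒᵖ ↔ IsLeftPP B := by
  constructor
  · intro hB a
    obtain ⟨e, he, hae⟩ := hB (.op a)
    refine ⟨e.unop, congrArg MulOpposite.unop he, Set.ext fun b => ?_⟩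
    have := Set.ext_iff.1 hae (.op b)
    simpa [← MulOpposite.op_mul, MulOpposite.exists, ← MulOpposite.unop_inj] using this
  · intro hB a
    obtain ⟨e, he, hae⟩ := hB a.unop
    refine ⟨.op e, congrArg MulOpposite.op he, Set.ext fun b => ?_⟩
    have := Set.ext_iff.1 hae b.unop
    simpa [MulOpposite.exists, ← MulOpposite.unop_inj] using this

theorem isLeftPP_mulOpposite : IsLeftPP Bᵐᵒᵖ ↔ IsRightPP B := by
  constructor
  · intro hB a
    obtain ⟨e, he, hae⟩ := hB (.op a)
    refine ⟨e.unop, congrArg MulOpposite.unop he, Set.ext fun b => ?_⟩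
    have := Set.ext_iff.1 hae (.op b)
    simpa [← MulOpposite.op_mul, MulOpposite.exists, ← MulOpposite.unop_inj] using this
  · intro hB a
    obtain ⟨e, he, hae⟩ := hB a.unop
    refine ⟨.op e, congrArg MulOpposite.op he, Set.ext fun b => ?_⟩
    have := Set.ext_iff.1 hae b.unop
    simpa [MulOpposite.exists, ← MulOpposite.unop_inj] using this

theorem isRightPP_iff_isLeftPP (hc : ∀ e : B, IsIdempotentElem e → ∀ b, e * b = b * e) :
    IsRightPP B ↔ IsLeftPP B := by
  refine ⟨fun hB => hB.isLeftPP hc, fun hB => isLeftPP_mulOpposite.1 ?_⟩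
  refine (isRightPP_mulOpposite.2 hB).isLeftPP fun e he b => ?_
  exact MulOpposite.unop_injective (hc e.unop (congrArg MulOpposite.unop he) b.unop).symm

theorem IsRightPP.of_ringEquiv {C : Type*} [Ring C] (φ : B ≃+* C) (hB : IsRightPP B) :
    IsRightPP C := by
  intro a
  obtain ⟨e, he, hae⟩ := hB (φ.symm a)
  refine ⟨φ e, he.map φ, Set.ext fun b => ?_⟩
  have := Set.ext_iff.1 hae (φ.symm b)
  simp only [Set.mem_ofPred_eq, ← map_mul, EmbeddingLike.map_eq_zero_iff] at this ⊢
  rw [this]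
  refine ⟨fun ⟨c, hc⟩ => ⟨φ c, ?_⟩, fun ⟨c, hc⟩ => ⟨φ.symm c, ?_⟩⟩
  · rw [← map_mul, ← hc, φ.apply_symm_apply]
  · rw [hc, map_mul, φ.symm_apply_apply]

theorem isRightPP_congr {C : Type*} [Ring C] (φ : B ≃+* C) : IsRightPP B ↔ IsRightPP C :=
  ⟨.of_ringEquiv φ, .of_ringEquiv φ.symm⟩

theorem isLeftPP_congr {C : Type*} [Ring C] (φ : B ≃+* C) : IsLeftPP B ↔ IsLeftPP C := by
  rw [← isRightPP_mulOpposite, ← isRightPP_mulOpposite]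
  exact isRightPP_congr (RingEquiv.op φ)

/-- The right annihilator as the fixed points of left multiplication by an idempotent; this form
lets annihilators be transported by ring homomorphisms fixing idempotents. -/
theorem IsRightPP.exists_forall_mul_eq_zero_iff (hB : IsRightPP B) (a : B) :
    ∃ e : B, IsIdempotentElem e ∧ ∀ b, a * b = 0 ↔ e * b = b := by
  obtain ⟨e, he, hae⟩ := hB a
  refine ⟨e, he, fun b => (Set.ext_iff.1 hae b).trans ⟨?_, fun hb => ⟨b, hb.symm⟩⟩⟩
  rintro ⟨c, rfl⟩
  rw [← mul_assoc, he.eq]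

theorem IsRightPP.exists_forall_finset_mul_eq_zero_iff (hB : IsRightPP B)
    (hc : ∀ e : B, IsIdempotentElem e → ∀ b, e * b = b * e) {ι : Type*} (s : Finset ι)
    (a : ι → B) :
    ∃ e : B, IsIdempotentElem e ∧ ∀ b, (∀ i ∈ s, a i * b = 0) ↔ e * b = b := by
  classical
  induction s using Finset.induction_on with
  | empty => exact ⟨1, .one, by simp⟩
  | insert i s hi ih =>
    obtain ⟨e, he, hs⟩ := ih
    obtain ⟨e', he', hi⟩ := hB.exists_forall_mul_eq_zero_iff (a i)
    refine ⟨e * e', he.mul_of_commute (hc e he e') he', fun b => ?_⟩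
    rw [Finset.forall_mem_insert, hs, hi]
    constructor
    · rintro ⟨h1, h2⟩
      rw [mul_assoc, h1, h2]
    · intro hb
      constructor
      · rw [← hb, ← mul_assoc, ← mul_assoc, ← hc e he, mul_assoc e, he'.eq]
      · rw [← hb, ← mul_assoc, ← mul_assoc, he.eq]

end Ring

namespace IsSkewPBWExtension

variable {A : Type*} [Ring A] {R : Subring A} {n : ℕ} {x : Fin n → A}

/-! ### Idempotents in a skew-Armendariz extension -/

theorem ext_coeff (h : IsSkewPBWExtension R x) {f g : A}
    (hfg : ∀ α, h.coeff f α = h.coeff g α) : f = g :=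
  h.basis.repr.injective (Finsupp.ext hfg)

theorem coeff_one (h : IsSkewPBWExtension R x) (α : Fin n → ℕ) :
    h.coeff 1 α = if 0 = α then 1 else 0 := h.coeff_coe 1 α

theorem coeff_sub (h : IsSkewPBWExtension R x) (f g : A) (α : Fin n → ℕ) :
    h.coeff (f - g) α = h.coeff f α - h.coeff g α := by
  simp [coeff]

/-- Without variables the only standard monomial is `1`. -/
theorem subring_eq_top {x : Fin 0 → A} (h : IsSkewPBWExtension R x) : R = ⊤ := by
  refine top_unique fun f _ => ?_
  have : f = (h.coeff f 0 : A) := h.ext_coeff fun α => by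
    rw [Subsingleton.elim α 0, coeff_coe, if_pos rfl]
  rw [this]
  exact (h.coeff f 0).2

theorem IsSkewArmendariz.mul_eq_zero_of_linear {h : IsSkewPBWExtension R x}
    (harm : h.IsSkewArmendariz) (i : Fin n) {a b c d : R}
    (H : ((a : A) * x i + b) * ((c : A) * x i + d) = 0) : b * c = 0 ∧ b * d = 0 := by
  have h1 := harm _ _ H (Pi.single i 1)
  have h0 := harm _ _ H 0
  rw [(h.coeff_linear i a b).2] at h0 h1
  rw [(h.coeff_linear i c d).1] at h1
  rw [(h.coeff_linear i c d).2] at h0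
  exact ⟨h1, h0⟩

/-- Apply the skew-Armendariz condition to `(x_i e) (1 - e) = 0` and to `(x_i (1 - e)) e = 0`. -/
theorem IsSkewArmendariz.delta_eq_zero {h : IsSkewPBWExtension R x}
    (harm : h.IsSkewArmendariz) (i : Fin n) {e : R} (he : IsIdempotentElem e) :
    h.delta i e = 0 := by
  have key : ∀ e : R, IsIdempotentElem e → h.delta i e * (1 - e) = 0 := by
    intro e he
    refine (harm.mul_eq_zero_of_linear i (a := h.sigma i e) (c := 0) ?_).2
    rw [← h.var_mul_coe]
    have : (e : A) * ((1 - e : R) : A) = 0 := by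
      rw [← Subring.coe_mul, he.mul_one_sub_self, Subring.coe_zero]
    rw [Subring.coe_zero, zero_mul, zero_add, mul_assoc, this, mul_zero]
  have hsub : h.delta i (1 - e) = - h.delta i e := by
    have hne : Pi.single i 1 ≠ (0 : Fin n → ℕ) := by simp
    simp [delta, mul_sub, coeff_sub, coeff_var, hne]
  have h1 := key e he
  have h2 := key (1 - e) he.one_sub
  rw [hsub, sub_sub_cancel, neg_mul, neg_eq_zero] at h2
  rwa [mul_sub, mul_one, h2, sub_zero] at h1

/-- Since `δ_i(e) = 0`, the linear polynomials `(1 - e) σ_i(e) x_i + (1 - e)` and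
`(e - 1) σ_i(e) x_i + e` have product zero, which forces `(1 - e) σ_i(e) = 0`; the same holds with
`1 - e` in place of `e`. -/
theorem IsSkewArmendariz.sigma_eq_self {h : IsSkewPBWExtension R x}
    (harm : h.IsSkewArmendariz) (i : Fin n) {e : R} (he : IsIdempotentElem e) :
    h.sigma i e = e := by
  have key : ∀ e : R, IsIdempotentElem e → (1 - e) * h.sigma i e = 0 := by
    intro e he
    have hx : x i * (e : A) = (h.sigma i e : A) * x i := by
      rw [h.var_mul_coe, harm.delta_eq_zero i he, Subring.coe_zero, add_zero]
    have hs : IsIdempotentElem (h.sigma i e) := he.map _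
    have := (harm.mul_eq_zero_of_linear i (a := (1 - e) * h.sigma i e) (b := 1 - e)
      (c := (e - 1) * h.sigma i e) (d := e) ?_).1
    · rw [← neg_sub 1 e, neg_mul, mul_neg, neg_eq_zero, ← mul_assoc, he.one_sub.eq] at this
      exact this
    · have hee : (e : A) * e = e := congrArg Subtype.val he.eq
      have hss : (h.sigma i e : A) * h.sigma i e = h.sigma i e := congrArg Subtype.val hs.eq
      push_cast
      generalize (h.sigma i e : A) = s at *
      generalize (e : A) = e at *
      have h1 : s * x i * (e - 1) = 0 := by
        rw [mul_sub, mul_assoc, hx, ← mul_assoc, hss, mul_one, sub_self]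
      have h2 : s * x i * e = s * x i := by rw [mul_assoc, hx, ← mul_assoc, hss]
      have h3 : (1 - e) * e = 0 := by rw [sub_mul, hee, one_mul, sub_self]
      have h4 : (1 - e) * (e - 1) = -(1 - e) := by
        rw [mul_sub, h3, mul_one, zero_sub]
      calc ((1 - e) * s * x i + (1 - e)) * ((e - 1) * s * x i + e)
          = (1 - e) * (s * x i * (e - 1)) * s * x i + (1 - e) * (s * x i * e)
            + (1 - e) * (e - 1) * s * x i + (1 - e) * e := by noncomm_ring
        _ = 0 := by rw [h1, h2, h3, h4]; noncomm_ring
  have h1 := key e he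
  have h2 := key (1 - e) he.one_sub
  rw [sub_sub_cancel, map_sub, map_one, mul_sub, mul_one, sub_eq_zero] at h2
  rw [sub_mul, one_mul, sub_eq_zero] at h1
  rw [h1, ← h2]

theorem IsSkewArmendariz.var_mul_idempotent {h : IsSkewPBWExtension R x}
    (harm : h.IsSkewArmendariz) (i : Fin n) {e : R} (he : IsIdempotentElem e) :
    x i * (e : A) = e * x i := by
  rw [h.var_mul_coe, harm.delta_eq_zero i he, harm.sigma_eq_self i he, Subring.coe_zero, add_zero]

/-- Since `x_i` commutes with `e`, the linear polynomials `e - e r (1 - e) x_i` and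
`(1 - e) + e r (1 - e) x_i` have product zero, which forces `e r (1 - e) = 0`; the same holds with
`1 - e` in place of `e`. The index `i` only serves to provide a variable: with `n = 0` the
skew-Armendariz condition is void, and idempotents of `R` need not be central. -/
theorem IsSkewArmendariz.idempotent_comm {h : IsSkewPBWExtension R x}
    (harm : h.IsSkewArmendariz) (i : Fin n) {e : R} (he : IsIdempotentElem e) (r : R) :
    e * r = r * e := by
  have key : ∀ e : R, IsIdempotentElem e → e * r * (1 - e) = 0 := by
    intro e he
    have := (harm.mul_eq_zero_of_linear i (a := -(e * r * (1 - e))) (b := e)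
      (c := e * r * (1 - e)) (d := 1 - e) ?_).1
    · rwa [mul_assoc e r, ← mul_assoc, he.eq, ← mul_assoc] at this
    · have hee : (e : A) * e = e := congrArg Subtype.val he.eq
      have hx := harm.var_mul_idempotent i he
      push_cast
      generalize (e : A) = e at *
      generalize (r : A) = r at *
      have h3 : (1 - e) * e = 0 := by rw [sub_mul, hee, one_mul, sub_self]
      have h3' : e * (1 - e) = 0 := by rw [mul_sub, hee, mul_one, sub_self]
      have h4 : (1 - e) * (1 - e) = 1 - e := by
        rw [mul_sub, h3, mul_one, sub_zero]
      have hx' : x i * (1 - e) = (1 - e) * x i := by rw [mul_sub, sub_mul, hx]; simp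
      calc (-(e * r * (1 - e)) * x i + e) * (e * r * (1 - e) * x i + (1 - e))
          = -(e * r * (1 - e) * (x i * e) * r * (1 - e) * x i)
            - e * r * (1 - e) * (x i * (1 - e))
            + e * e * r * (1 - e) * x i + e * (1 - e) := by noncomm_ring
        _ = -(e * r * ((1 - e) * e) * x i * r * (1 - e) * x i)
            - e * r * ((1 - e) * (1 - e)) * x i
            + e * e * r * (1 - e) * x i + e * (1 - e) := by rw [hx, hx']; noncomm_ring
        _ = 0 := by rw [h3, h3', h4, hee]; noncomm_ring
  have h1 := key e he
  have h2 := key (1 - e) he.one_sub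
  rw [sub_sub_cancel, sub_mul, sub_mul, one_mul, sub_eq_zero] at h2
  rw [mul_sub, mul_one, sub_eq_zero] at h1
  rw [h1, ← h2]

theorem IsSkewArmendariz.idempotent_central {h : IsSkewPBWExtension R x}
    (harm : h.IsSkewArmendariz) (i₀ : Fin n) {e : R} (he : IsIdempotentElem e) (f : A) :
    (e : A) * f = f * e := by
  have hf : f ∈ Submodule.span R (Set.range (stdMonomial x)) := h.span_eq_top trivial
  induction hf using Submodule.span_induction with
  | zero => simp
  | add f g _ _ hf hg => rw [mul_add, add_mul, hf, hg]
  | smul r f _ hf =>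
    change (e : A) * (r * f) = r * f * e
    have := congrArg Subtype.val (harm.idempotent_comm i₀ he r)
    push_cast at this
    rw [← mul_assoc, this, mul_assoc, hf, mul_assoc]
  | mem f hf =>
    obtain ⟨α, rfl⟩ := hf
    refine Commute.list_prod_right _ _ fun y hy => ?_
    obtain ⟨i, rfl⟩ := List.mem_ofFn.1 hy
    exact Commute.pow_right (harm.var_mul_idempotent i he).symm _

/-- Every idempotent of `A` equals its constant coefficient. -/
theorem IsSkewArmendariz.exists_coe_eq_of_idempotent {h : IsSkewPBWExtension R x}
    (harm : h.IsSkewArmendariz) {e : A} (he : IsIdempotentElem e) :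
    ∃ r : R, IsIdempotentElem r ∧ (r : A) = e := by
  have h1 := harm _ _ he.mul_one_sub_self
  have h2 := harm _ _ he.one_sub_mul_self
  have h0 : (h.coeff e 0 : A) = e := h.ext_coeff fun α => by
    have h1 := h1 α
    have h2 := h2 α
    rw [coeff_coe]
    rw [coeff_sub, coeff_one] at h1 h2
    split_ifs at h1 ⊢ with hα
    · rw [hα]
    · rw [if_pos rfl, sub_mul, one_mul, sub_eq_zero] at h2
      rw [zero_sub, mul_neg, neg_eq_zero] at h1
      rw [h2, h1]
  exact ⟨_, Subtype.ext (by push_cast; rw [h0]; exact he), h0⟩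

end IsSkewPBWExtension

/-! ### The degree-lexicographic filtration -/

theorem var_mul_stdMonomial {A : Type*} [Ring A] {n : ℕ} (x : Fin n → A) {i : Fin n}
    {β : Fin n → ℕ} (hβ : ∀ j < i, β j = 0) :
    x i * stdMonomial x β = stdMonomial x (Pi.single i 1 + β) := by
  induction n with
  | zero => exact i.elim0
  | succ n ih =>
    rw [stdMonomial_succ, stdMonomial_succ]
    revert hβ
    refine Fin.cases (fun _ => ?_) (fun i hβ => ?_) i
    · have : (fun k : Fin n => (Pi.single 0 1 + β : Fin (n + 1) → ℕ) k.succ)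
          = fun k : Fin n => β k.succ := by
        ext k; simp
      rw [this, ← mul_assoc, Pi.add_apply, Pi.single_eq_same, pow_add, pow_one]
    · have : (fun k : Fin n => (Pi.single i.succ 1 + β : Fin (n + 1) → ℕ) k.succ)
          = Pi.single i 1 + fun k : Fin n => β k.succ := by
        ext k; simp [Pi.single_apply]
      rw [this, ← ih (fun k => x k.succ) (fun j hj => hβ _ (Fin.succ_lt_succ_iff.2 hj)),
        Pi.add_apply, hβ 0 (Fin.succ_pos i)]
      simp [(Fin.succ_ne_zero i).symm]

/-- A nonzero exponent loses one from its first nonzero entry. -/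
theorem exists_eq_single_add {n : ℕ} {β : Fin n → ℕ} (hβ : β ≠ 0) :
    ∃ (i : Fin n) (γ : Fin n → ℕ), (∀ j < i, γ j = 0) ∧ β = Pi.single i 1 + γ := by
  classical
  have hne : (Finset.univ.filter fun j => β j ≠ 0).Nonempty := by
    obtain ⟨j, hj⟩ := Function.ne_iff.1 hβ
    exact ⟨j, by simpa using hj⟩
  have hi := Finset.min'_mem _ hne
  set i := Finset.min' _ hne with hidef
  have hmin : ∀ j < i, β j = 0 := fun j hj => by
    by_contra hj'
    exact absurd (Finset.min'_le _ j (by simpa using hj')) (not_le.2 hj)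
  have hi : β i ≠ 0 := by simpa using hi
  have hle : (Pi.single i 1 : Fin n → ℕ) ≤ β := by
    intro k
    by_cases hk : k = i
    · subst hk; simpa [Nat.one_le_iff_ne_zero] using hi
    · simp [hk]
  refine ⟨i, β - Pi.single i 1, fun j hj => by simp [hmin j hj], ?_⟩
  rw [add_tsub_cancel_of_le hle]

/-- The degree-lexicographic degree of an exponent: the total degree, then the exponent itself in
the lexicographic order. -/
def degLex {n : ℕ} (α : Fin n → ℕ) : ℕ ×ₗ Lex (Fin n → ℕ) :=
  toLex (∑ i, α i, toLex α)

theorem degLex_injective {n : ℕ} : Function.Injective (degLex (n := n)) := fun α β hαβ => by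
  have := congrArg (fun p => ofLex (ofLex p).2) hαβ
  exact this

theorem degLex_add {n : ℕ} (α β : Fin n → ℕ) : degLex (α + β) = degLex α + degLex β := by
  simp only [degLex, Pi.add_apply, Finset.sum_add_distrib]
  rfl

theorem degLex_lt_of_sum_lt {n : ℕ} {α β : Fin n → ℕ} (hαβ : ∑ i, α i < ∑ i, β i) :
    degLex α < degLex β :=
  Prod.Lex.toLex_lt_toLex.2 (Or.inl hαβ)

theorem sum_single_add {n : ℕ} (i : Fin n) (β : Fin n → ℕ) :
    ∑ k, (Pi.single i 1 + β : Fin n → ℕ) k = 1 + ∑ k, β k := by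
  simp [Finset.sum_add_distrib]

/-- The left `R`-submodule of `A` spanned by the standard monomials with exponent in `P`. -/
def monomialSpan {A : Type*} [Ring A] (R : Subring A) {n : ℕ} (x : Fin n → A)
    (P : Set (Fin n → ℕ)) : Submodule R A :=
  Submodule.span R (stdMonomial x '' P)

/-- The elements of total degree at most `d`. -/
abbrev sumLE {A : Type*} [Ring A] (R : Subring A) {n : ℕ} (x : Fin n → A) (d : ℕ) :
    Submodule R A :=
  monomialSpan R x {γ | ∑ i, γ i ≤ d}

/-- The elements all of whose monomials have degree below `t` in the degree-lexicographic order. -/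
abbrev degLexLT {A : Type*} [Ring A] (R : Subring A) {n : ℕ} (x : Fin n → A)
    (t : ℕ ×ₗ Lex (Fin n → ℕ)) : Submodule R A :=
  monomialSpan R x {γ | degLex γ < t}

section monomialSpan

variable {A : Type*} [Ring A] {R : Subring A} {n : ℕ} {x : Fin n → A}

theorem monomialSpan_mono {P Q : Set (Fin n → ℕ)} (hPQ : P ⊆ Q) :
    monomialSpan R x P ≤ monomialSpan R x Q :=
  Submodule.span_mono (Set.image_mono hPQ)

theorem stdMonomial_mem {P : Set (Fin n → ℕ)} {α : Fin n → ℕ} (hα : α ∈ P) :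
    stdMonomial x α ∈ monomialSpan R x P :=
  Submodule.subset_span ⟨α, hα, rfl⟩

theorem coe_mul_mem {M : Submodule R A} (r : R) {f : A} (hf : f ∈ M) : (r : A) * f ∈ M :=
  M.smul_mem r hf

end monomialSpan

namespace IsSkewPBWExtension

variable {A : Type*} [Ring A] {R : Subring A} {n : ℕ} {x : Fin n → A}

theorem mem_monomialSpan (h : IsSkewPBWExtension R x) {P : Set (Fin n → ℕ)} {f : A} :
    f ∈ monomialSpan R x P ↔ ∀ γ, h.coeff f γ ≠ 0 → γ ∈ P := by
  have : stdMonomial x = h.basis := funext fun α => (h.basis_apply α).symm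
  rw [monomialSpan, this, Module.Basis.mem_span_image]
  simp [Set.subset_def, coeff]

theorem var_mul_mem (h : IsSkewPBWExtension R x) (i : Fin n) {P : Set (Fin n → ℕ)}
    {M : Submodule R A} (hP : ∀ γ ∈ P, stdMonomial x γ ∈ M ∧ x i * stdMonomial x γ ∈ M) {f : A}
    (hf : f ∈ monomialSpan R x P) : x i * f ∈ M := by
  suffices f ∈ M ∧ x i * f ∈ M from this.2
  induction hf using Submodule.span_induction with
  | zero => simp
  | add f g _ _ hf hg => exact ⟨add_mem hf.1 hg.1, by rw [mul_add]; exact add_mem hf.2 hg.2⟩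
  | mem f hf =>
    obtain ⟨γ, hγ, rfl⟩ := hf
    exact hP γ hγ
  | smul r f _ hf =>
    refine ⟨M.smul_mem r hf.1, ?_⟩
    change x i * (r * f) ∈ M
    rw [← mul_assoc, h.var_mul_coe, add_mul, mul_assoc]
    exact add_mem (coe_mul_mem _ hf.2) (coe_mul_mem _ hf.1)

/-- Left multiplication by a variable acts on a standard monomial as the addition of exponents, up
to a unit coefficient and terms of smaller total degree. -/
theorem IsBijective.var_mul_stdMonomial {h : IsSkewPBWExtension R x} (hbij : h.IsBijective)
    (i : Fin n) (β : Fin n → ℕ) :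
    ∃ u : R, IsUnit u ∧
      x i * stdMonomial x β - u * stdMonomial x (Pi.single i 1 + β) ∈ sumLE R x (∑ k, β k) := by
  obtain ⟨d, hd⟩ : ∃ d, ∑ k, β k = d := ⟨_, rfl⟩
  induction d using Nat.strong_induction_on generalizing i β with
  | _ d ih =>
    by_cases hi : ∀ j < i, β j = 0
    · exact ⟨1, isUnit_one, by simp [SkewPBW.var_mul_stdMonomial x hi]⟩
    have hβ0 : β ≠ 0 := by rintro rfl; simp at hi
    obtain ⟨j, γ, hγ, rfl⟩ := exists_eq_single_add hβ0
    rw [sum_single_add] at hd ⊢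
    have hji : j < i := by
      by_contra hij
      refine hi fun k hk => ?_
      have hkj := hk.trans_le (not_lt.1 hij)
      simp [hγ k hkj, hkj.ne]
    -- a variable raises the total degree by at most one, as long as it stays at most `d`
    have hmem : ∀ (k : Fin n) (α : Fin n → ℕ), ∑ l, α l ≤ ∑ l, γ l →
        x k * stdMonomial x α ∈ sumLE R x (1 + ∑ l, γ l) := by
      intro k α hα
      obtain ⟨u, -, hu⟩ := ih _ (by omega) k α rfl
      rw [← sub_add_cancel (x k * _) (u * stdMonomial x (Pi.single k 1 + α))]
      refine add_mem (monomialSpan_mono (fun δ hδ => ?_) hu) (coe_mul_mem _ (stdMonomial_mem ?_))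
      · change ∑ l, δ l ≤ _ at hδ
        change ∑ l, δ l ≤ _
        omega
      · change ∑ l, (Pi.single k 1 + α : Fin n → ℕ) l ≤ _
        rw [sum_single_add]
        omega
    have hmem' : ∀ α : Fin n → ℕ, ∑ l, α l ≤ 1 + ∑ l, γ l →
        stdMonomial x α ∈ sumLE R x (1 + ∑ l, γ l) := fun α hα => stdMonomial_mem hα
    -- `x_i x_j` is replaced by `c x_j x_i` plus linear terms; then `x_i` acts on the shorter `x^γ`,
    -- and `x_j` with `j < i` can be put in front of the result, `γ` vanishing below `j`
    obtain ⟨u, hu, hs⟩ := ih _ (by omega) i γ rfl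
    obtain ⟨r₀, r, hr⟩ := h.swapCoeff_spec hji
    refine ⟨h.swapCoeff j i * h.sigma j u, (hbij.2 j i hji).mul (hu.map _), ?_⟩
    have hexp : Pi.single i 1 + (Pi.single j 1 + γ) = Pi.single j 1 + (Pi.single i 1 + γ) := by
      abel
    rw [hexp, ← SkewPBW.var_mul_stdMonomial x hγ, ← SkewPBW.var_mul_stdMonomial x (i := j)
      (β := Pi.single i 1 + γ) (fun k hk => by simp [hγ k hk, (hk.trans hji).ne])]
    set s := x i * stdMonomial x γ - u * stdMonomial x (Pi.single i 1 + γ) with hsdef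
    have hxs : x j * s ∈ sumLE R x (1 + ∑ l, γ l) :=
      h.var_mul_mem j (fun α (hα : ∑ l, α l ≤ _) => ⟨hmem' α (by omega), hmem j α hα⟩) hs
    have key : x i * (x j * stdMonomial x γ)
        - (h.swapCoeff j i * h.sigma j u : R) * (x j * stdMonomial x (Pi.single i 1 + γ))
        = h.swapCoeff j i * (h.delta j u * stdMonomial x (Pi.single i 1 + γ))
          + h.swapCoeff j i * (x j * s)
          + (r₀ * stdMonomial x γ + ∑ k, r k * (x k * stdMonomial x γ)) := by
      have h1 : x i * x j = h.swapCoeff j i * (x j * x i) + (r₀ + ∑ k, (r k : A) * x k) := by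
        rw [← hr]; abel
      have h2 := h.var_mul_coe j u
      have h3 : x i * stdMonomial x γ = s + u * stdMonomial x (Pi.single i 1 + γ) := by
        rw [hsdef]; abel
      have h4 : (∑ k, (r k : A) * x k) * stdMonomial x γ
          = ∑ k, r k * (x k * stdMonomial x γ) := by
        rw [Finset.sum_mul]
        exact Finset.sum_congr rfl fun k _ => mul_assoc _ _ _
      have h5 : x j * (u * stdMonomial x (Pi.single i 1 + γ))
          = h.sigma j u * (x j * stdMonomial x (Pi.single i 1 + γ))
            + h.delta j u * stdMonomial x (Pi.single i 1 + γ) := by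
        rw [← mul_assoc, h2, add_mul, mul_assoc]
      rw [← mul_assoc (x i), h1, add_mul, add_mul, h4, mul_assoc, mul_assoc, h3, mul_add, h5,
        Subring.coe_mul]
      noncomm_ring
    rw [key]
    refine add_mem (add_mem (coe_mul_mem _ (coe_mul_mem _ (hmem' _ (sum_single_add i γ).le)))
      (coe_mul_mem _ hxs)) (add_mem (coe_mul_mem _ (hmem' _ (by omega)))
      (sum_mem fun k _ => coe_mul_mem _ (hmem k γ le_rfl)))

theorem IsBijective.var_mul_stdMonomial_degLexLT {h : IsSkewPBWExtension R x}
    (hbij : h.IsBijective) (i : Fin n) (β : Fin n → ℕ) :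
    ∃ u : R, IsUnit u ∧
      x i * stdMonomial x β - u * stdMonomial x (Pi.single i 1 + β) ∈
        degLexLT R x (degLex (Pi.single i 1 + β)) := by
  obtain ⟨u, hu, hs⟩ := hbij.var_mul_stdMonomial i β
  refine ⟨u, hu, monomialSpan_mono (fun γ (hγ : ∑ k, γ k ≤ _) => degLex_lt_of_sum_lt ?_) hs⟩
  rw [sum_single_add]
  omega

theorem IsBijective.var_mul_mem_degLexLT {h : IsSkewPBWExtension R x}
    (hbij : h.IsBijective) (i : Fin n) (β : Fin n → ℕ) {f : A}
    (hf : f ∈ degLexLT R x (degLex β)) : x i * f ∈ degLexLT R x (degLex (Pi.single i 1 + β)) := by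
  refine h.var_mul_mem i (fun γ (hγ : degLex γ < degLex β) => ?_) hf
  have hlt : degLex (Pi.single i 1 + γ) < degLex (Pi.single i 1 + β) := by
    rw [degLex_add, degLex_add]
    exact add_lt_add_right hγ _
  have hlt' : degLex γ < degLex (Pi.single i 1 + γ) :=
    degLex_lt_of_sum_lt (by rw [sum_single_add]; omega)
  refine ⟨stdMonomial_mem (hlt'.trans hlt), ?_⟩
  obtain ⟨u, -, hs⟩ := hbij.var_mul_stdMonomial_degLexLT i γ
  rw [← sub_add_cancel (x i * _) (u * stdMonomial x (Pi.single i 1 + γ))]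
  exact add_mem (monomialSpan_mono (fun δ (hδ : degLex δ < _) => hδ.trans hlt) hs)
    (coe_mul_mem _ (stdMonomial_mem hlt))

/-! ### Leading terms of products, and annihilators in the extension -/

theorem IsBijective.stdMonomial_mul_mem_degLexLT {h : IsSkewPBWExtension R x}
    (hbij : h.IsBijective) (α β : Fin n → ℕ) {g : A} (hg : g ∈ degLexLT R x (degLex β)) :
    stdMonomial x α * g ∈ degLexLT R x (degLex (α + β)) := by
  obtain ⟨d, hd⟩ : ∃ d, ∑ k, α k = d := ⟨_, rfl⟩
  induction d generalizing α with
  | zero =>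
    obtain rfl : α = 0 := funext fun i => by simpa using (Finset.sum_eq_zero_iff.1 hd) i
    rwa [stdMonomial_zero, one_mul, zero_add]
  | succ d ih =>
    obtain ⟨i, γ, hγ, rfl⟩ := exists_eq_single_add (β := α) (by rintro rfl; simp at hd)
    rw [sum_single_add] at hd
    rw [← SkewPBW.var_mul_stdMonomial x hγ, mul_assoc, add_assoc]
    exact hbij.var_mul_mem_degLexLT i _ (ih γ (by omega))

theorem IsBijective.mul_mem_degLexLT {h : IsSkewPBWExtension R x} (hbij : h.IsBijective)
    {α β : Fin n → ℕ} {f g : A} (hf : f ∈ degLexLT R x (degLex α))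
    (hg : g ∈ degLexLT R x (degLex β)) : f * g ∈ degLexLT R x (degLex (α + β)) := by
  induction hf using Submodule.span_induction with
  | zero => simp
  | add f f' _ _ hf hf' => rw [add_mul]; exact add_mem hf hf'
  | smul r f _ hf =>
    rw [smul_mul_assoc]
    exact Submodule.smul_mem _ r hf
  | mem f hf =>
    obtain ⟨γ, hγ : degLex γ < degLex α, rfl⟩ := hf
    refine monomialSpan_mono (fun δ (hδ : degLex δ < _) => hδ.trans ?_)
      (hbij.stdMonomial_mul_mem_degLexLT γ β hg)
    rw [degLex_add, degLex_add]
    exact add_lt_add_left hγ _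

/-- The leading term of a product `x^α (r x^β)`. Only those features of its coefficient `k` are
recorded that matter for annihilators: an element killing `k` on the left kills `r`. -/
theorem IsBijective.exists_stdMonomial_mul {h : IsSkewPBWExtension R x} (hbij : h.IsBijective)
    (hσ : ∀ (i : Fin n) (a r : R), a * h.sigma i r = 0 → a * r = 0)
    (α β : Fin n → ℕ) (r : R) :
    ∃ k : R, (∀ a, a * k = 0 → a * r = 0) ∧
      stdMonomial x α * (r * stdMonomial x β) - k * stdMonomial x (α + β) ∈
        degLexLT R x (degLex (α + β)) := by
  obtain ⟨d, hd⟩ : ∃ d, ∑ k, α k = d := ⟨_, rfl⟩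
  induction d generalizing α with
  | zero =>
    obtain rfl : α = 0 := funext fun i => by simpa using (Finset.sum_eq_zero_iff.1 hd) i
    exact ⟨r, fun a ha => ha, by simp [stdMonomial_zero]⟩
  | succ d ih =>
    obtain ⟨i, γ, hγ, rfl⟩ := exists_eq_single_add (β := α) (by rintro rfl; simp at hd)
    rw [sum_single_add] at hd
    obtain ⟨k, hk, hs⟩ := ih γ (by omega)
    obtain ⟨u, hu, ht⟩ := hbij.var_mul_stdMonomial_degLexLT i (γ + β)
    refine ⟨h.sigma i k * u, fun a ha => hk a (hσ i a k ?_), ?_⟩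
    · rw [← mul_assoc] at ha
      exact (hu.mul_left_eq_zero).1 ha
    rw [← SkewPBW.var_mul_stdMonomial x hγ, add_assoc]
    have hs' := hbij.var_mul_mem_degLexLT i _ hs
    have hlow : degLex (γ + β) < degLex (Pi.single i 1 + (γ + β)) :=
      degLex_lt_of_sum_lt (by rw [sum_single_add]; omega)
    have key : x i * stdMonomial x γ * (r * stdMonomial x β)
        - (h.sigma i k * u : R) * stdMonomial x (Pi.single i 1 + (γ + β))
        = x i * (stdMonomial x γ * (r * stdMonomial x β) - k * stdMonomial x (γ + β))
          + h.delta i k * stdMonomial x (γ + β)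
          + h.sigma i k * (x i * stdMonomial x (γ + β)
            - u * stdMonomial x (Pi.single i 1 + (γ + β))) := by
      rw [mul_sub (x i), ← mul_assoc (x i) (k : A), h.var_mul_coe, Subring.coe_mul]
      noncomm_ring
    rw [key]
    exact add_mem (add_mem hs' (coe_mul_mem _ (stdMonomial_mem hlow))) (coe_mul_mem _ ht)

theorem sub_leadingTerm_mem_degLexLT (h : IsSkewPBWExtension R x) {f : A} {α : Fin n → ℕ}
    (hf : ∀ γ, h.coeff f γ ≠ 0 → degLex γ ≤ degLex α) :
    f - h.coeff f α * stdMonomial x α ∈ degLexLT R x (degLex α) := by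
  refine h.mem_monomialSpan.2 fun γ hγ => ?_
  rw [coeff_sub, coeff_mul_left, coeff_stdMonomial] at hγ
  split_ifs at hγ with hαγ
  · subst hαγ; simp at hγ
  · rw [mul_zero, sub_zero] at hγ
    exact lt_of_le_of_ne (hf γ hγ) fun hne => hαγ (degLex_injective hne).symm

/-- `α` and `β` are upper bounds for the monomials of `f` and `g` in the degree-lexicographic order;
the coefficient of `x^(α + β)` in `f g` is computed from the terms with exponents `α` and `β`. -/
theorem IsBijective.leadingCoeff_mul_eq_zero {h : IsSkewPBWExtension R x} (hbij : h.IsBijective)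
    (hσ : ∀ (i : Fin n) (a r : R), a * h.sigma i r = 0 → a * r = 0) {f g : A} (hfg : f * g = 0)
    {α β : Fin n → ℕ} (hf : ∀ γ, h.coeff f γ ≠ 0 → degLex γ ≤ degLex α)
    (hg : ∀ γ, h.coeff g γ ≠ 0 → degLex γ ≤ degLex β) :
    h.coeff f α * h.coeff g β = 0 := by
  set a := h.coeff f α
  set b := h.coeff g β
  have hf' := h.sub_leadingTerm_mem_degLexLT hf
  have hg' := h.sub_leadingTerm_mem_degLexLT hg
  set f' := f - a * stdMonomial x α with hf'def
  set g' := g - b * stdMonomial x β with hg'def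
  obtain ⟨k, hk, hs⟩ := hbij.exists_stdMonomial_mul hσ α β b
  refine hk a ?_
  have hlow : f' * (b * stdMonomial x β) ∈ degLexLT R x (degLex (α + β)) := by
    refine Submodule.span_induction (p := fun f' _ => f' * (b * stdMonomial x β) ∈
      degLexLT R x (degLex (α + β))) ?_ (by simp) (fun f f' _ _ hf hf' => by
        rw [add_mul]; exact add_mem hf hf') (fun r f _ hf => by
        rw [smul_mul_assoc]; exact Submodule.smul_mem _ r hf) hf'
    rintro _ ⟨γ, hγ : degLex γ < degLex α, rfl⟩
    have hlt : degLex (γ + β) < degLex (α + β) := by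
      rw [degLex_add, degLex_add]
      exact add_lt_add_left hγ _
    obtain ⟨k, -, hs⟩ := hbij.exists_stdMonomial_mul hσ γ β b
    rw [← sub_add_cancel (stdMonomial x γ * _) (k * stdMonomial x (γ + β))]
    exact add_mem (monomialSpan_mono (fun δ (hδ : degLex δ < _) => hδ.trans hlt) hs)
      (coe_mul_mem _ (stdMonomial_mem hlt))
  have key : ((a * k : R) : A) * stdMonomial x (α + β)
      = -(a * (stdMonomial x α * (b * stdMonomial x β) - k * stdMonomial x (α + β))
        + a * (stdMonomial x α * g') + f' * (b * stdMonomial x β) + f' * g') := by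
    have hf0 : f = a * stdMonomial x α + f' := by rw [hf'def]; abel
    have hg0 : g = b * stdMonomial x β + g' := by rw [hg'def]; abel
    have h0 : (a * stdMonomial x α + f') * (b * stdMonomial x β + g') = 0 := by
      rw [← hf0, ← hg0, hfg]
    rw [eq_neg_iff_add_eq_zero, ← h0, Subring.coe_mul]
    noncomm_ring
  have hmem : ((a * k : R) : A) * stdMonomial x (α + β) ∈ degLexLT R x (degLex (α + β)) := by
    rw [key]
    exact neg_mem (add_mem (add_mem (add_mem (coe_mul_mem _ hs)
      (coe_mul_mem _ (hbij.stdMonomial_mul_mem_degLexLT α β hg'))) hlow)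
      (hbij.mul_mem_degLexLT hf' hg'))
  by_contra hne
  suffices hlt : degLex (α + β) < degLex (α + β) from lt_irrefl _ hlt
  refine h.mem_monomialSpan.1 hmem (α + β) ?_
  rwa [coeff_mul_left, coeff_stdMonomial, if_pos rfl, mul_one]

/-- The right annihilator of `a` is `eR` with `σ_i(e) = e`, so it is invariant under the inverse of
`σ_i`. -/
theorem IsSkewArmendariz.mul_eq_zero_of_mul_sigma {h : IsSkewPBWExtension R x}
    (harm : h.IsSkewArmendariz) (hbij : h.IsBijective) (hR : IsRightPP R) (i : Fin n) {a r : R}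
    (har : a * h.sigma i r = 0) : a * r = 0 := by
  obtain ⟨e, he, hae⟩ := hR.exists_forall_mul_eq_zero_iff a
  refine (hae r).2 ((hbij.1 i).1 ?_)
  rw [map_mul, harm.sigma_eq_self i he]
  exact (hae _).1 har

/-- Over a right p.p.-ring the skew-Armendariz condition extends from the constant coefficient of `f`
to all its coefficients. The induction is on the sizes of the supports. If `q` generates the right annihilator of the
leading coefficient of `f`, then `q f` has lost the leading term of `f`, and `(1 - q) g` that
of `g`. -/
theorem IsSkewArmendariz.coeff_mul_coeff_eq_zero {h : IsSkewPBWExtension R x}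
    (harm : h.IsSkewArmendariz) (hbij : h.IsBijective) (hR : IsRightPP R) (i₀ : Fin n) {f g : A}
    (hfg : f * g = 0) (α β : Fin n → ℕ) : h.coeff f α * h.coeff g β = 0 := by
  obtain ⟨N, hN⟩ : ∃ N, (h.basis.repr f).support.card + (h.basis.repr g).support.card = N :=
    ⟨_, rfl⟩
  induction N using Nat.strong_induction_on generalizing f g with
  | _ N ih =>
    have hmem : ∀ (f : A) (γ : Fin n → ℕ), γ ∈ (h.basis.repr f).support ↔ h.coeff f γ ≠ 0 :=
      fun f γ => Finsupp.mem_support_iff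
    obtain hf | hf := (h.basis.repr f).support.eq_empty_or_nonempty
    · have : h.coeff f α = 0 := by
        by_contra hne
        simpa [hf] using (hmem f α).2 hne
      rw [this, zero_mul]
    obtain hg | hg := (h.basis.repr g).support.eq_empty_or_nonempty
    · have : h.coeff g β = 0 := by
        by_contra hne
        simpa [hg] using (hmem g β).2 hne
      rw [this, mul_zero]
    obtain ⟨α', hα', hmaxf⟩ := Finset.exists_max_image _ degLex hf
    obtain ⟨β', hβ', hmaxg⟩ := Finset.exists_max_image _ degLex hg
    have h0 : h.coeff f α' * h.coeff g β' = 0 := hbij.leadingCoeff_mul_eq_zero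
      (fun i _ _ => harm.mul_eq_zero_of_mul_sigma hbij hR i) hfg
      (fun γ hγ => hmaxf γ ((hmem f γ).2 hγ)) (fun γ hγ => hmaxg γ ((hmem g γ).2 hγ))
    obtain ⟨q, hq, hann⟩ := hR.exists_forall_mul_eq_zero_iff (h.coeff f α')
    -- a left multiple of `f` that loses a monomial has smaller support
    have hcard : ∀ (f : A) (r : R) (γ : Fin n → ℕ), γ ∈ (h.basis.repr f).support →
        r * h.coeff f γ = 0 →
        (h.basis.repr ((r : A) * f)).support.card < (h.basis.repr f).support.card := by
      intro f r γ hγ hr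
      refine Finset.card_lt_card ((Finset.ssubset_iff_of_subset fun δ hδ => ?_).2
        ⟨γ, hγ, fun hγ' => (hmem _ γ).1 hγ' (by rw [coeff_mul_left, hr])⟩)
      rw [hmem, coeff_mul_left] at hδ
      exact (hmem f δ).2 (right_ne_zero_of_mul hδ)
    have hq1 : q * h.coeff f α' = 0 := by
      rw [harm.idempotent_comm i₀ hq, hann, hq.eq]
    have hq2 : (1 - q) * h.coeff g β' = 0 := by
      rw [sub_mul, one_mul, (hann _).1 h0, sub_self]
    have H1 := ih _ (by have := hcard f q α' hα' hq1; omega) (f := (q : A) * f) (g := g)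
      (by rw [mul_assoc, hfg, mul_zero]) rfl
    have H2 := ih _ (by have := hcard g (1 - q) β' hβ' hq2; omega) (f := f)
      (g := ((1 - q : R) : A) * g)
      (by rw [← mul_assoc, ← harm.idempotent_central i₀ hq.one_sub, mul_assoc, hfg, mul_zero]) rfl
    rw [coeff_mul_left] at H1 H2
    rw [harm.idempotent_comm i₀ hq, mul_assoc] at H1
    rw [sub_mul, one_mul, mul_sub, H1, sub_zero] at H2
    exact H2

theorem IsSkewArmendariz.isRightPP {h : IsSkewPBWExtension R x}
    (harm : h.IsSkewArmendariz) (hbij : h.IsBijective) (i₀ : Fin n) (hR : IsRightPP R) :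
    IsRightPP A := by
  intro f
  obtain ⟨e, he, hann⟩ := hR.exists_forall_finset_mul_eq_zero_iff
    (fun e he => harm.idempotent_comm i₀ he) (h.basis.repr f).support (h.coeff f)
  have hfe : f * (e : A) = 0 := by
    rw [← harm.idempotent_central i₀ he]
    refine h.ext_coeff fun α => ?_
    rw [coeff_mul_left, harm.idempotent_comm i₀ he]
    by_cases hα : h.coeff f α = 0
    · rw [hα, zero_mul]
      simp [coeff]
    · rw [(hann e).2 he.eq α (Finsupp.mem_support_iff.2 hα)]
      simp [coeff]
  refine ⟨e, congrArg Subtype.val he.eq, Set.ext fun g => ⟨fun (hg : f * g = 0) => ⟨g, ?_⟩, ?_⟩⟩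
  · refine h.ext_coeff fun β => ?_
    rw [coeff_mul_left, (hann _).1]
    exact fun α _ => harm.coeff_mul_coeff_eq_zero hbij hR i₀ hg α β
  · rintro ⟨c, rfl⟩
    change f * (e * c) = 0
    rw [← mul_assoc, hfe, zero_mul]

theorem IsSkewArmendariz.isRightPP_subring {h : IsSkewPBWExtension R x}
    (harm : h.IsSkewArmendariz) (hA : IsRightPP A) : IsRightPP R := by
  intro a
  obtain ⟨e', he', hann⟩ := hA.exists_forall_mul_eq_zero_iff (a : A)
  obtain ⟨e, he, rfl⟩ := harm.exists_coe_eq_of_idempotent he'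
  refine ⟨e, he, Set.ext fun b => ⟨fun hb => ⟨b, ?_⟩, ?_⟩⟩
  · exact Subtype.ext ((hann b).1 (congrArg Subtype.val hb)).symm
  · rintro ⟨c, rfl⟩
    refine Subtype.ext ((hann _).2 ?_)
    push_cast
    rw [← mul_assoc, he'.eq]

end IsSkewPBWExtension
end SkewPBW

theorem mainTheorem3 {A : Type*} [Ring A] (R : Subring A) {n : ℕ} (x : Fin n → A)
    (h : SkewPBW.IsSkewPBWExtension R x) (hbij : h.IsBijective) (harm : h.IsSkewArmendariz) :
    (SkewPBW.IsRightPP R ↔ SkewPBW.IsRightPP A) ∧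
      (SkewPBW.IsLeftPP R ↔ SkewPBW.IsLeftPP A) := by
  obtain _ | n := n
  · obtain rfl := h.subring_eq_top
    exact ⟨SkewPBW.isRightPP_congr Subring.topEquiv, SkewPBW.isLeftPP_congr Subring.topEquiv⟩
  have hright : SkewPBW.IsRightPP R ↔ SkewPBW.IsRightPP A :=
    ⟨harm.isRightPP hbij 0, harm.isRightPP_subring⟩
  refine ⟨hright, ?_⟩
  rw [← SkewPBW.isRightPP_iff_isLeftPP (B := R) fun e he => harm.idempotent_comm 0 he,
    ← SkewPBW.isRightPP_iff_isLeftPP (B := A) fun e he b => ?_, hright]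
  obtain ⟨r, hr, rfl⟩ := harm.exists_coe_eq_of_idempotent he
  exact harm.idempotent_central 0 hr b
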